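/- Let $\langle\cdot,\cdot\rangle:\omega^2\to\omega$ be a standard computable bijective pairing function, and for $A\subseteq\omega$ let $A^{[n]}=\{x : \langle x,n\rangle\in A\}$ be the $n$-th column of $A$. For $D\subseteq\omega$ let $\Phi^D_e$ be the $e$-th partial function computable with oracle $D$ (in a standard numbering of oracle programs), let $W^D_e=\mathrm{dom}\,\Phi^D_e$, let $D'=\{e : \Phi^D_e(e)\text{ halts}\}$ be the Turing jump of $D$, and let $\emptyset''=(\emptyset')'$; let $(W_e)_{e\in\omega}$ be the standard indexing of the c.e. sets. Define equivalence relations on $\omega$ by - $i\;E^{ce}_{\mathrm{Cof}}\;j$ iff for every $n$, $W_i^{[n]}$ is cofinite if and only if $W_j^{[n]}$ is cofinite; - $i\;E^{ce}_{\mathrm{set}}\;j$ iff $\{W_i^{[n]} : n\in\omega\}=\{W_j^{[n]} : n\in\omega\}$; - $i\;E^{2}_{=}\;j$ iff $W_i^{\emptyset''}=W_j^{\emptyset''}$. For equivalence relations $E,F$ on $\omega$ write $E\le_c F$ if there is a total computable function $g:\omega\to\omega$ such that for all $x,y\in\omega$, $x\;E\;y$ if and only if $g(x)\;F\;g(y)$;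 and call $E$ and $F$ computably bireducible, written $E\equiv_c F$, if $E\le_c F$ and $F\le_c E$. **Theorem.** Any two of $E^{ce}_{\mathrm{Cof}}$, $E^{ce}_{\mathrm{set}}$ and $E^2_=$ are computably bireducible: $E^{ce}_{\mathrm{Cof}}\equiv_c E^{ce}_{\mathrm{set}}\equiv_c E^2_=$. -/

import Mathlib

/-! Computable reducibility of equivalence relations on `ℕ`, oracle computation, the Turing jump,
and the equivalence relations `E_Cof^ce`, `E_set^ce` and `E_=^n`. -/

namespace CompRed

/-! ### Computable reducibility -/

/-- `E ≤_c F`: some total computable `g` satisfies `x E y ↔ g x F g y` for all `x, y`. -/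
def Reducible (E F : Setoid ℕ) : Prop :=
  ∃ g : ℕ → ℕ, Computable g ∧ ∀ x y : ℕ, E x y ↔ F (g x) (g y)

/-- `E ≡_c F`: `E` and `F` are computably bireducible. -/
def Bireducible (E F : Setoid ℕ) : Prop :=
  Reducible E F ∧ Reducible F E

/-! ### Computably enumerable sets and oracle computation -/

/-- `W_e = dom φ_e`, the `e`-th c.e. set, where `φ_e` is the partial computable function whose
program has code number `e`. -/
def W (e : ℕ) : Set ℕ :=
  {x | ((Denumerable.ofNat Nat.Partrec.Code e).eval x).Dom}

/-- Programs with an oracle: the programs `Nat.Partrec.Code` of Mathlib with one further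
instruction, which queries the oracle. -/
inductive OCode : Type
  | zero : OCode
  | succ : OCode
  | left : OCode
  | right : OCode
  | oracle : OCode
  | pair : OCode → OCode → OCode
  | comp : OCode → OCode → OCode
  | prec : OCode → OCode → OCode
  | rfind' : OCode → OCode

namespace OCode

/-- The partial function computed by an oracle program when the oracle is the total function `g`.
All clauses except `oracle` are those of `Nat.Partrec.Code.eval`. -/
def eval (g : ℕ → ℕ) : OCode → ℕ →. ℕ
  | zero => pure 0
  | succ => Nat.succ
  | left => ↑fun n : ℕ => n.unpair.1
  | right => ↑fun n : ℕ => n.unpair.2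
  | oracle => g
  | pair cf cg => fun n => Nat.pair <$> eval g cf n <*> eval g cg n
  | comp cf cg => fun n => eval g cg n >>= eval g cf
  | prec cf cg =>
    Nat.unpaired fun a n =>
      n.rec (eval g cf a) fun y IH => do
        let i ← IH
        eval g cg (Nat.pair a (Nat.pair y i))
  | rfind' cf =>
    Nat.unpaired fun a m =>
      (Nat.rfind fun n => (fun m => m = 0) <$> eval g cf (Nat.pair a (m + n))).map (· + m)

/-- The standard numbering of the oracle programs, the analogue of `Nat.Partrec.Code.ofNatCode`. -/
def ofNat : ℕ → OCode
  | 0 => zero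
  | 1 => succ
  | 2 => left
  | 3 => right
  | 4 => oracle
  | n + 5 =>
    let m := n.div2.div2
    have hm : m < n + 5 := by
      simp only [m, Nat.div2_val]
      exact
        lt_of_le_of_lt (le_trans (Nat.div_le_self _ _) (Nat.div_le_self _ _))
          (Nat.lt_add_of_pos_right (by decide))
    have _m1 : m.unpair.1 < n + 5 := lt_of_le_of_lt m.unpair_left_le hm
    have _m2 : m.unpair.2 < n + 5 := lt_of_le_of_lt m.unpair_right_le hm
    match n.bodd, n.div2.bodd with
    | false, false => pair (ofNat m.unpair.1) (ofNat m.unpair.2)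
    | false, true => comp (ofNat m.unpair.1) (ofNat m.unpair.2)
    | true, false => prec (ofNat m.unpair.1) (ofNat m.unpair.2)
    | true, true => rfind' (ofNat m)
termination_by n => n
decreasing_by all_goals assumption

end OCode

open Classical in
/-- `Φ_e^D`, the `e`-th partial function computable with oracle the (characteristic function of
the) set `D`. -/
noncomputable def Phi (D : Set ℕ) (e : ℕ) : ℕ →. ℕ :=
  (OCode.ofNat e).eval fun n => if n ∈ D then 1 else 0

/-- `W_e^D = dom Φ_e^D`. -/
def WIn (D : Set ℕ) (e : ℕ) : Set ℕ :=
  {x | (Phi D e x).Dom}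

/-- The Turing jump `D' = {e | Φ_e^D(e) halts}`. -/
def jump (D : Set ℕ) : Set ℕ :=
  {e | (Phi D e e).Dom}

/-! ### The equivalence relations -/

/-- The `n`-th column `A^[n] = {x | ⟨x, n⟩ ∈ A}`. -/
def column (A : Set ℕ) (n : ℕ) : Set ℕ :=
  {x | Nat.pair x n ∈ A}

/-- `A E_Cof B`: for every `n`, `A^[n]` is cofinite iff `B^[n]` is cofinite. -/
def ECof : Setoid (Set ℕ) where
  r A B := ∀ n : ℕ, (column A n)ᶜ.Finite ↔ (column B n)ᶜ.Finite
  iseqv := ⟨fun _ _ => Iff.rfl, fun h n => (h n).symm, fun h k n => (h n).trans (k n)⟩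

/-- `A E_set B`: `A` and `B` have the same set of columns. -/
def ESet : Setoid (Set ℕ) where
  r A B := {C | ∃ n : ℕ, C = column A n} = {C | ∃ n : ℕ, C = column B n}
  iseqv := ⟨fun _ => rfl, fun h => h.symm, fun h k => h.trans k⟩

/-- The relation `E^ce` on indices of c.e. sets: `i E^ce j` iff `W_i E W_j`. -/
def ce (E : Setoid (Set ℕ)) : Setoid ℕ :=
  E.comap W

/-- `i E_=^n j` iff `W_i` and `W_j` relative to the `n`-th jump of `∅` are equal. -/
def EEq (n : ℕ) : Setoid ℕ where
  r i j := WIn (jump^[n] ∅) i = WIn (jump^[n] ∅) j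
  iseqv := ⟨fun _ => rfl, fun h => h.symm, fun h k => h.trans k⟩

end CompRed

namespace CompRed

/-! ### The arithmetical hierarchy -/

/-! All three relations are equality of uniformly `Σ⁰_3` sets. For `ECof` the set attached to `i`
consists of the `n` with cofinite `n`-th column; for `ESet`, of the `e` such that `W e` is a column
of `W i`. Sets that are uniformly `Σ⁰_3` are uniformly c.e. in the second jump (`exists_WIn_iff`),
hence both reduce to `EEq 2`.

Conversely, the use principle makes membership in `WIn (jump^[2] ∅) z` a `Σ⁰_3` relation, of the
form `∃ a, ∀ b, ∃ c, P` with `P` primitive recursive. Such a relation has to be coded into c.e.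
columns. For `ESet`, every finite segment of each row is a column, and a guess `a` yields a column
that grows as long as the guess survives; only a correct guess adds the full row
(`setOf_column_eq`). For `ECof`, a primitive recursive sequence takes some value infinitely often
iff a correct guess exists, and the stages with a later value at most as large form a c.e. set that
is cofinite in exactly that case (`finite_compl_setOf_exists_le_iff`,
`exists_infinite_stageValue_iff`). The remaining equivalence follows by transitivity. -/

/-- `R` is `Σ⁰_n`: primitive recursive for `n = 0`, and of the form `∃ a, ¬ Q (x, a)` with `Q` in
`Σ⁰_n` at level `n + 1`. -/
def IsSigma : ℕ → ∀ {α : Type} [Primcodable α], (α → Prop) → Prop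
  | 0, _, _, R => PrimrecPred R
  | n + 1, α, _, R => ∃ Q : α × ℕ → Prop, IsSigma n Q ∧ ∀ x, R x ↔ ∃ a, ¬ Q (x, a)

namespace IsSigma

variable {α β : Type} [Primcodable α] [Primcodable β] {n : ℕ}

theorem of_iff {P Q : α → Prop} (hP : IsSigma n P) (h : ∀ x, Q x ↔ P x) : IsSigma n Q := by
  rwa [show Q = P from funext fun x => propext (h x)]

theorem comp {R : β → Prop} {f : α → β} (hR : IsSigma n R) (hf : Primrec f) :
    IsSigma n fun x => R (f x) := by
  induction n generalizing α β with
  | zero => exact PrimrecPred.comp hR hf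
  | succ n ih =>
    obtain ⟨Q, hQ, h⟩ := hR
    exact ⟨fun p => Q (f p.1, p.2), ih hQ ((hf.comp .fst).pair .snd), fun x => h (f x)⟩

theorem not {R : α → Prop} (hR : IsSigma n R) : IsSigma (n + 1) fun x => ¬ R x :=
  ⟨fun p => R p.1, hR.comp .fst, fun x => by simp⟩

theorem succ {R : α → Prop} (hR : IsSigma n R) : IsSigma (n + 1) R := by
  induction n generalizing α with
  | zero => exact (not (n := 0) (PrimrecPred.not hR)).of_iff fun x => by simp
  | succ n ih =>
    obtain ⟨Q, hQ, h⟩ := hR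
    exact ⟨Q, ih hQ, h⟩

theorem of_primrecPred {R : α → Prop} (hR : PrimrecPred R) : IsSigma n R := by
  induction n with
  | zero => exact hR
  | succ n ih => exact ih.succ

theorem exists_nat {R : α × ℕ → Prop} (hR : IsSigma (n + 1) R) :
    IsSigma (n + 1) fun x => ∃ a, R (x, a) := by
  obtain ⟨Q, hQ, h⟩ := hR
  refine ⟨fun p => Q ((p.1, p.2.unpair.1), p.2.unpair.2), hQ.comp ?_, fun x => ?_⟩
  · have := Primrec.unpair.comp (Primrec.snd (α := α) (β := ℕ))
    exact (Primrec.fst.pair (Primrec.fst.comp this)).pair (Primrec.snd.comp this)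
  · simp only [h]
    constructor
    · rintro ⟨a, b, hb⟩
      exact ⟨Nat.pair a b, by simpa using hb⟩
    · rintro ⟨a, ha⟩
      exact ⟨_, _, ha⟩

theorem exists_encodable [Inhabited β] {R : α × β → Prop} (hR : IsSigma (n + 1) R) :
    IsSigma (n + 1) fun x => ∃ b, R (x, b) := by
  have hd : Primrec fun p : α × ℕ => (p.1, (Encodable.decode (α := β) p.2).getD default) :=
    Primrec.fst.pair (Primrec.option_getD.comp (Primrec.decode.comp .snd) (.const _))
  refine (hR.comp hd).exists_nat.of_iff fun x => ⟨?_, ?_⟩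
  · rintro ⟨b, hb⟩
    exact ⟨Encodable.encode b, by simpa using hb⟩
  · rintro ⟨a, ha⟩
    exact ⟨_, ha⟩

/-- The matrix is negated at each level, so conjunction at level `n + 1` needs disjunction at level
`n`; hence the joint induction. -/
theorem and_or {P Q : α → Prop} (hP : IsSigma n P) (hQ : IsSigma n Q) :
    (IsSigma n fun x => P x ∧ Q x) ∧ IsSigma n fun x => P x ∨ Q x := by
  induction n generalizing α with
  | zero => exact ⟨PrimrecPred.and hP hQ, PrimrecPred.or hP hQ⟩
  | succ n ih =>
    obtain ⟨P', hP', hp⟩ := hP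
    obtain ⟨Q', hQ', hq⟩ := hQ
    constructor
    · have hu := Primrec.unpair.comp (Primrec.snd (α := α) (β := ℕ))
      refine ⟨fun p => P' (p.1, p.2.unpair.1) ∨ Q' (p.1, p.2.unpair.2),
        (ih (hP'.comp (Primrec.fst.pair (Primrec.fst.comp hu)))
          (hQ'.comp (Primrec.fst.pair (Primrec.snd.comp hu)))).2, fun x => ?_⟩
      simp only [hp, hq, not_or]
      constructor
      · rintro ⟨⟨a, ha⟩, b, hb⟩
        exact ⟨Nat.pair a b, by simpa using ⟨ha, hb⟩⟩
      · rintro ⟨a, ha, hb⟩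
        exact ⟨⟨_, ha⟩, _, hb⟩
    · refine ⟨fun p => P' p ∧ Q' p, (ih hP' hQ').1, fun x => ?_⟩
      simp only [hp, hq, not_and_or, exists_or]

theorem and {P Q : α → Prop} (hP : IsSigma n P) (hQ : IsSigma n Q) :
    IsSigma n fun x => P x ∧ Q x := (and_or hP hQ).1

theorem or {P Q : α → Prop} (hP : IsSigma n P) (hQ : IsSigma n Q) :
    IsSigma n fun x => P x ∨ Q x := (and_or hP hQ).2

theorem forall_nat {R : α × ℕ → Prop} (hR : IsSigma n R) :
    IsSigma (n + 2) fun x => ∀ a, R (x, a) :=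
  (not hR).exists_nat.not.of_iff fun x => by simp

/-- Collection: witnesses for all `k` below the bound are gathered in one list. Negating what
remains leaves a bounded `∃` one level down, so both quantifiers are treated together. -/
theorem exists_lt_forall_lt {R : α × ℕ → Prop} (hR : IsSigma n R) :
    (IsSigma n fun p : α × ℕ => ∃ k < p.2, R (p.1, k)) ∧
      IsSigma n fun p : α × ℕ => ∀ k < p.2, R (p.1, k) := by
  induction n generalizing α with
  | zero =>
    have hr : PrimrecRel fun (k : ℕ) (x : α) => R (x, k) :=
      PrimrecPred.comp (f := fun p : ℕ × α => (p.2, p.1)) hR (Primrec.snd.pair .fst)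
    have hl := Primrec.list_range.comp (Primrec.snd (α := α) (β := ℕ))
    exact ⟨(hr.exists_mem_list.comp hl .fst).of_eq (by simp),
      (hr.forall_mem_list.comp hl .fst).of_eq (by simp)⟩
  | succ n ih =>
    constructor
    · have h1 : IsSigma (n + 1) fun q : (α × ℕ) × ℕ => q.2 < q.1.2 ∧ R (q.1.1, q.2) :=
        and (of_primrecPred (Primrec.nat_lt.comp .snd (Primrec.snd.comp .fst)))
          (hR.comp ((Primrec.fst.comp .fst).pair .snd))
      exact h1.exists_nat
    · obtain ⟨Q, hQ, h⟩ := hR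
      have hf : Primrec fun q : (α × List ℕ) × ℕ => ((q.1.1, q.2), q.1.2.getD q.2 0) :=
        ((Primrec.fst.comp .fst).pair .snd).pair
          ((Primrec.list_getD 0).comp (Primrec.snd.comp .fst) .snd)
      have hg : Primrec fun q : (α × ℕ) × List ℕ => ((q.1.1, q.2), q.1.2) :=
        ((Primrec.fst.comp .fst).pair .snd).pair (Primrec.snd.comp .fst)
      refine (exists_encodable (not ((ih (hQ.comp hf)).1.comp hg))).of_iff fun x => ?_
      simp only [h, not_exists, not_and]
      constructor
      · intro H
        choose! s hs using H
        refine ⟨(List.range x.2).map s, fun k hk => ?_⟩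
        have : ((List.range x.2).map s).getD k 0 = s k := by simp [List.getD, hk]
        rw [this]
        exact hs k hk
      · rintro ⟨s, hs⟩ k hk
        exact ⟨_, hs k hk⟩

theorem forall_lt {R : α × ℕ → Prop} (hR : IsSigma n R) :
    IsSigma n fun p : α × ℕ => ∀ k < p.2, R (p.1, k) := hR.exists_lt_forall_lt.2

/-- Membership in c.e. sets is `Σ⁰_1`. -/
theorem mem_W : IsSigma 1 fun p : ℕ × ℕ => p.2 ∈ W p.1 := by
  have h : PrimrecPred fun q : (ℕ × ℕ) × ℕ =>
      (Nat.Partrec.Code.evaln q.2 (Denumerable.ofNat Nat.Partrec.Code q.1.1) q.1.2).isSome = true :=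
    Primrec.eq.comp (Primrec.option_isSome.comp (Nat.Partrec.Code.primrec_evaln.comp
      ((Primrec.snd.pair ((Primrec.ofNat _).comp (Primrec.fst.comp .fst))).pair
        (Primrec.snd.comp .fst)))) (.const true)
  refine (exists_nat (of_primrecPred h)).of_iff fun p => ?_
  simp only [W, Set.mem_ofPred_eq, Part.dom_iff_mem, Nat.Partrec.Code.evaln_complete,
    Option.isSome_iff_exists, Option.mem_def]
  exact exists_comm

end IsSigma

/-- A `Σ⁰_1` relation has c.e. sections, uniformly. -/
theorem exists_W_iff {R : ℕ × ℕ → Prop} (hR : IsSigma 1 R) :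
    ∃ g : ℕ → ℕ, Primrec g ∧ ∀ z x, x ∈ W (g z) ↔ R (z, x) := by
  obtain ⟨Q, ⟨hdec, hQ⟩, h⟩ := hR
  have hq : Primrec fun p : ℕ × ℕ => !decide (Q (p.1.unpair, p.2)) :=
    Primrec.not.comp (hQ.comp ((Primrec.unpair.comp .fst).pair .snd))
  have hp : Nat.Partrec fun m => Nat.rfind fun a => Part.some (!decide (Q (m.unpair, a))) :=
    Partrec.nat_iff.1 (Partrec.rfind hq.to_comp.partrec.to₂)
  obtain ⟨c, hc⟩ := Nat.Partrec.Code.exists_code.1 hp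
  refine ⟨fun z => Encodable.encode (c.curry z), Primrec.encode.comp
    (Nat.Partrec.Code.primrec₂_curry.comp (.const c) .id), fun z x => ?_⟩
  have hd : ∀ p : ℕ → Bool, (Nat.rfind fun a => Part.some (p a)).Dom ↔ ∃ a, p a = true := fun p =>
    Nat.rfind_dom.trans (exists_congr fun a => ⟨fun ha => (Part.mem_some_iff.1 ha.1).symm,
      fun ha => ⟨Part.mem_some_iff.2 ha.symm, fun _ => trivial⟩⟩)
  simp [W, hc, h, hd]

/-! ### Oracle programs -/

namespace OCode

open Nat.Partrec (Code)

theorem ofNat_add_five (n : ℕ) : ofNat (n + 5) =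
    match n.bodd, n.div2.bodd with
    | false, false => pair (ofNat n.div2.div2.unpair.1) (ofNat n.div2.div2.unpair.2)
    | false, true => comp (ofNat n.div2.div2.unpair.1) (ofNat n.div2.div2.unpair.2)
    | true, false => prec (ofNat n.div2.div2.unpair.1) (ofNat n.div2.div2.unpair.2)
    | true, true => rfind' (ofNat n.div2.div2) := by
  cases h : n.bodd <;> cases h' : n.div2.bodd <;> simp [ofNat, h, h']

/-- The code number of `pair` applied to the programs with code numbers `a` and `b`. -/
def pairNum (a b : ℕ) : ℕ := 2 * (2 * Nat.pair a b) + 5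

/-- The code number of `comp` applied to the programs with code numbers `a` and `b`. -/
def compNum (a b : ℕ) : ℕ := 2 * (2 * Nat.pair a b + 1) + 5

theorem ofNat_pairNum (a b : ℕ) : ofNat (pairNum a b) = pair (ofNat a) (ofNat b) := by
  rw [pairNum, ofNat_add_five]
  simp [Nat.div2_val]

theorem ofNat_compNum (a b : ℕ) : ofNat (compNum a b) = comp (ofNat a) (ofNat b) := by
  rw [compNum, ofNat_add_five]
  have : (2 * (2 * Nat.pair a b + 1)).div2 = 2 * Nat.pair a b + 1 := by simp [Nat.div2_val]
  simp [this]

theorem ofNat_surjective : Function.Surjective ofNat := by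
  intro c
  induction c with
  | zero => exact ⟨0, by rw [ofNat]⟩
  | succ => exact ⟨1, by rw [ofNat]⟩
  | left => exact ⟨2, by rw [ofNat]⟩
  | right => exact ⟨3, by rw [ofNat]⟩
  | oracle => exact ⟨4, by rw [ofNat]⟩
  | pair _ _ ha hb =>
    obtain ⟨a, rfl⟩ := ha
    obtain ⟨b, rfl⟩ := hb
    exact ⟨_, ofNat_pairNum a b⟩
  | comp _ _ ha hb =>
    obtain ⟨a, rfl⟩ := ha
    obtain ⟨b, rfl⟩ := hb
    exact ⟨_, ofNat_compNum a b⟩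
  | prec _ _ ha hb =>
    obtain ⟨a, rfl⟩ := ha
    obtain ⟨b, rfl⟩ := hb
    -- After subtracting 5, the two lowest bits of a number select the constructor.
    refine ⟨2 * (2 * Nat.pair a b) + 1 + 5, ?_⟩
    have : (2 * Nat.pair a b).div2 = Nat.pair a b := by rw [Nat.div2_val]; omega
    rw [ofNat_add_five]
    simp [this]
  | rfind' _ ha =>
    obtain ⟨a, rfl⟩ := ha
    refine ⟨2 * (2 * a + 1) + 1 + 5, ?_⟩
    rw [ofNat_add_five]
    simp

theorem primrec₂_pairNum : Primrec₂ pairNum :=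
  Primrec.nat_add.comp (Primrec.nat_mul.comp (.const 2) (Primrec.nat_mul.comp (.const 2)
    (Primrec₂.natPair.comp .fst .snd))) (.const 5)

theorem primrec₂_compNum : Primrec₂ compNum :=
  Primrec.nat_add.comp (Primrec.nat_mul.comp (.const 2) (Primrec.nat_add.comp
    (Primrec.nat_mul.comp (.const 2) (Primrec₂.natPair.comp .fst .snd)) (.const 1))) (.const 5)

/-- A code number of a program for the constant function with value `z`. -/
def constNum : ℕ → ℕ
  | 0 => 0
  | z + 1 => compNum 1 (constNum z)

theorem primrec_constNum : Primrec constNum :=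
  (Primrec.nat_rec₁ 0 (primrec₂_compNum.comp (.const 1) .snd).to₂).of_eq fun n => by
    induction n with
    | zero => rfl
    | succ n ih => simp [constNum, ← ih]

theorem eval_constNum (g : ℕ → ℕ) (z x : ℕ) : (ofNat (constNum z)).eval g x = Part.some z := by
  induction z with
  | zero => simp [constNum, ofNat, eval]; rfl
  | succ z ih => 
    rw [constNum, ofNat_compNum]
    change (ofNat (constNum z)).eval g x >>= (ofNat 1).eval g = _
    rw [ih]
    exact (Part.bind_some _ _).trans (by simp [ofNat, eval])

/-- An ordinary program as an oracle program that makes no queries. -/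
def ofCode : Code → OCode
  | .zero => zero
  | .succ => succ
  | .left => left
  | .right => right
  | .pair a b => pair (ofCode a) (ofCode b)
  | .comp a b => comp (ofCode a) (ofCode b)
  | .prec a b => prec (ofCode a) (ofCode b)
  | .rfind' a => rfind' (ofCode a)

theorem eval_ofCode (g : ℕ → ℕ) (c : Code) : (ofCode c).eval g = c.eval := by
  induction c with
  | pair a b ha hb | comp a b ha hb | prec a b ha hb =>
    simp only [ofCode, eval, Code.eval, ha, hb]
    rfl
  | rfind' a ha =>
    simp only [ofCode, eval, Code.eval, ha, Nat.add_comm]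
    rfl
  | _ => rfl

/-- The program obtained from `c` by replacing every query by a call of `o`. -/
def substOracle (o : Code) : OCode → Code
  | zero => .zero
  | succ => .succ
  | left => .left
  | right => .right
  | oracle => o
  | pair a b => .pair (substOracle o a) (substOracle o b)
  | comp a b => .comp (substOracle o a) (substOracle o b)
  | prec a b => .prec (substOracle o a) (substOracle o b)
  | rfind' a => .rfind' (substOracle o a)

/-- Course-of-values recursion on the code number: `L` lists the earlier results, its length is the
current number, and subprograms have smaller numbers. -/
theorem primrec₂_substOracle : Primrec₂ fun (o : Code) n => substOracle o (ofNat n) := by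
  let G : Code → List Code → Code := fun o L =>
    let n := L.length - 5
    let a := L.getD n.div2.div2.unpair.1 .zero
    let b := L.getD n.div2.div2.unpair.2 .zero
    let c := L.getD n.div2.div2 .zero
    if L.length = 0 then .zero else if L.length = 1 then .succ else if L.length = 2 then .left
    else if L.length = 3 then .right else if L.length = 4 then o
    else if n.bodd = true then if n.div2.bodd = true then .rfind' c else .prec a b
    else if n.div2.bodd = true then .comp a b else .pair a b
  have hG : Primrec₂ G := by
    have hlen : Primrec fun p : Code × List Code => p.2.length := Primrec.list_length.comp .snd
    have hn := Primrec.nat_sub.comp hlen (.const 5)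
    have hm := Primrec.nat_div2.comp (Primrec.nat_div2.comp hn)
    have hget : ∀ {f : Code × List Code → ℕ}, Primrec f →
        Primrec fun p : Code × List Code => p.2.getD (f p) .zero :=
      fun hf => (Primrec.list_getD _).comp .snd hf
    have ha := hget (Primrec.fst.comp (Primrec.unpair.comp hm))
    have hb := hget (Primrec.snd.comp (Primrec.unpair.comp hm))
    have hc := hget hm
    have hbodd := fun {f : Code × List Code → ℕ} (hf : Primrec f) =>
      Primrec.eq.comp (Primrec.nat_bodd.comp hf) (Primrec.const true)
    exact .ite (Primrec.eq.comp hlen (.const 0)) (.const _) <|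
      .ite (Primrec.eq.comp hlen (.const 1)) (.const _) <|
      .ite (Primrec.eq.comp hlen (.const 2)) (.const _) <|
      .ite (Primrec.eq.comp hlen (.const 3)) (.const _) <|
      .ite (Primrec.eq.comp hlen (.const 4)) .fst <|
      .ite (hbodd hn)
        (.ite (hbodd (Primrec.nat_div2.comp hn)) (Code.primrec_rfind'.comp hc)
          (Code.primrec₂_prec.comp ha hb))
        (.ite (hbodd (Primrec.nat_div2.comp hn)) (Code.primrec₂_comp.comp ha hb)
          (Code.primrec₂_pair.comp ha hb))
  refine Primrec.nat_strong_rec _ (g := fun o L => some (G o L))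
    (Primrec.option_some.comp hG) fun o n => ?_
  match n with
  | 0 | 1 | 2 | 3 | 4 => simp [G, ofNat, substOracle]
  | n + 5 =>
    have hm : n.div2.div2 < n + 5 := by simp only [Nat.div2_val]; omega
    have ha : n.div2.div2.unpair.1 < n + 5 := (Nat.unpair_left_le _).trans_lt hm
    have hb : n.div2.div2.unpair.2 < n + 5 := (Nat.unpair_right_le _).trans_lt hm
    have key : ∀ i < n + 5, ((List.range (n + 5)).map
        fun n => substOracle o (ofNat n)).getD i .zero = substOracle o (ofNat i) := fun i hi => by
      simp [List.getD, hi]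
    simp only [G, List.length_map, List.length_range, Nat.add_sub_cancel, key _ ha, key _ hb,
      key _ hm, ofNat_add_five]
    rcases h1 : n.bodd <;> rcases h2 : n.div2.bodd <;> simp [substOracle]

theorem mem_pair_seq {p q : Part ℕ} {y : ℕ} :
    y ∈ Nat.pair <$> p <*> q ↔ ∃ u ∈ p, ∃ v ∈ q, Nat.pair u v = y := by
  simp [Seq.seq]

theorem mem_rfind_map {p : ℕ →. ℕ} {m y : ℕ} :
    y ∈ (Nat.rfind fun n => (fun m => decide (m = 0)) <$> p n).map (· + m) ↔
      ∃ w, (0 ∈ p w ∧ ∀ i < w, ∃ v ∈ p i, v ≠ 0) ∧ w + m = y := by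
  refine (Part.mem_map_iff _).trans (exists_congr fun w => and_congr_left fun _ =>
    Nat.mem_rfind.trans (and_congr ?_ (forall_congr' fun i => imp_congr_right fun _ => ?_)))
  · exact (Part.mem_map_iff _).trans (by simp)
  · exact (Part.mem_map_iff _).trans (by simp)

/-- Monotonicity: `o` computes only a part of `g`, so any computation that halts with it receives
true answers. -/
theorem eval_of_substOracle {g : ℕ → ℕ} {o : Code} (ho : ∀ n y, y ∈ o.eval n → y = g n)
    (c : OCode) : ∀ x y, y ∈ (substOracle o c).eval x → y ∈ c.eval g x := by
  induction c with
  | oracle => exact fun x y h => by simpa [eval] using ho _ _ h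
  | pair a b iha ihb =>
    intro x y h
    obtain ⟨u, hu, v, hv, e⟩ := mem_pair_seq.1 h
    exact mem_pair_seq.2 ⟨u, iha _ _ hu, v, ihb _ _ hv, e⟩
  | comp a b iha ihb =>
    intro x y h
    obtain ⟨u, hu, hv⟩ := Part.mem_bind_iff.1 h
    exact Part.mem_bind_iff.2 ⟨u, ihb _ _ hu, iha _ _ hv⟩
  | prec a b iha ihb =>
    intro x y
    simp only [substOracle, Code.eval, eval, Nat.unpaired]
    generalize x.unpair.1 = m
    generalize x.unpair.2 = n
    induction n generalizing y with
    | zero => exact iha _ _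
    | succ n ih =>
      intro h
      obtain ⟨u, hu, hv⟩ := Part.mem_bind_iff.1 h
      exact Part.mem_bind_iff.2 ⟨u, ih _ hu, ihb _ _ hv⟩
  | rfind' a iha =>
    intro x y h
    obtain ⟨w, ⟨h0, hw⟩, e⟩ := mem_rfind_map.1 h
    exact mem_rfind_map.2 ⟨w, ⟨iha _ _ (by rwa [Nat.add_comm]), fun i hi =>
      (hw i hi).imp fun v hv => ⟨iha _ _ (by rw [Nat.add_comm]; exact hv.1), hv.2⟩⟩, e⟩
  | _ => exact fun x y h => h

/-- A halting computation makes finitely many queries; `k` exceeds all of them, and `o` may diverge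
from `k` on. -/
theorem exists_use {g : ℕ → ℕ} (c : OCode) : ∀ x y, y ∈ c.eval g x →
    ∃ k, ∀ o : Code, (∀ n < k, g n ∈ o.eval n) → y ∈ (substOracle o c).eval x := by
  induction c with
  | oracle =>
    intro x y h
    refine ⟨x + 1, fun o ho => ?_⟩
    obtain rfl : y = g x := by simpa [eval] using h
    exact ho _ (Nat.lt_succ_self _)
  | pair a b iha ihb =>
    intro x y h
    obtain ⟨u, hu, v, hv, e⟩ := mem_pair_seq.1 h
    obtain ⟨k, hk⟩ := iha _ _ hu
    obtain ⟨l, hl⟩ := ihb _ _ hv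
    exact ⟨max k l, fun o ho => mem_pair_seq.2 ⟨u, hk o fun n hn => ho n (lt_max_of_lt_left hn), v,
      hl o fun n hn => ho n (lt_max_of_lt_right hn), e⟩⟩
  | comp a b iha ihb =>
    intro x y h
    obtain ⟨u, hu, hv⟩ := Part.mem_bind_iff.1 h
    obtain ⟨k, hk⟩ := iha _ _ hv
    obtain ⟨l, hl⟩ := ihb _ _ hu
    exact ⟨max k l, fun o ho => Part.mem_bind_iff.2 ⟨u, hl o fun n hn =>
      ho n (lt_max_of_lt_right hn), hk o fun n hn => ho n (lt_max_of_lt_left hn)⟩⟩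
  | prec a b iha ihb =>
    intro x y
    simp only [substOracle, Code.eval, eval, Nat.unpaired]
    generalize x.unpair.1 = m
    generalize x.unpair.2 = n
    induction n generalizing y with
    | zero => exact iha _ _
    | succ n ih =>
      intro h
      obtain ⟨u, hu, hv⟩ := Part.mem_bind_iff.1 h
      obtain ⟨k, hk⟩ := ihb _ _ hv
      obtain ⟨l, hl⟩ := ih _ hu
      exact ⟨max k l, fun o ho => Part.mem_bind_iff.2 ⟨u, hl o fun n hn =>
        ho n (lt_max_of_lt_right hn), hk o fun n hn => ho n (lt_max_of_lt_left hn)⟩⟩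
  | rfind' a iha =>
    intro x y h
    obtain ⟨w, ⟨h0, hw⟩, e⟩ := mem_rfind_map.1 h
    obtain ⟨k, hk⟩ := iha _ _ h0
    choose! v hv hv0 using hw
    choose! l hl using fun i (hi : i < w) => iha _ _ (hv i hi)
    refine ⟨max k ((Finset.range w).sup l), fun o ho => mem_rfind_map.2 ⟨w, ⟨?_, fun i hi => ⟨v i, ?_, hv0 i hi⟩⟩, e⟩⟩
    · rw [Nat.add_comm]
      exact hk o fun n hn => ho n (lt_max_of_lt_left hn)
    · rw [Nat.add_comm]
      exact hl i hi o fun n hn => ho n (lt_max_of_lt_right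
        (hn.trans_le (Finset.le_sup (f := l) (Finset.mem_range.2 hi))))
  | _ => exact fun x y h => ⟨0, fun _ _ => h⟩

end OCode

/-! ### Sets c.e. in a jump and the arithmetical hierarchy -/

open Nat.Partrec (Code)

open Classical in
/-- The characteristic function of `D`. -/
noncomputable def char (D : Set ℕ) (n : ℕ) : ℕ := if n ∈ D then 1 else 0

theorem char_eq_zero {D : Set ℕ} {n : ℕ} : char D n = 0 ↔ n ∉ D := by simp [char]

theorem mem_WIn {D : Set ℕ} {e x : ℕ} :
    x ∈ WIn D e ↔ ((OCode.ofNat e).eval (char D) x).Dom := Iff.rfl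

theorem mem_jump {D : Set ℕ} {e : ℕ} : e ∈ jump D ↔ e ∈ WIn D e := Iff.rfl

theorem OCode.eval_comp_of_eq {g : ℕ → ℕ} {a b : OCode} {x y : ℕ}
    (h : b.eval g x = Part.some y) : (a.comp b).eval g x = a.eval g y := by
  refine Eq.trans ?_ (Part.bind_some y (a.eval g))
  rw [← h]
  rfl

theorem OCode.exists_eval_eq {F : ℕ → ℕ} (hF : Primrec F) :
    ∃ c : OCode, ∀ g m, c.eval g m = Part.some (F m) := by
  obtain ⟨c, hc⟩ := Code.exists_code.1 (Partrec.nat_iff.1 hF.to_comp.partrec)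
  exact ⟨ofCode c, fun g m => by rw [eval_ofCode, hc]; rfl⟩

/-- Unbounded search for a zero of a total function computed with oracle `D`, uniformly in a
parameter. -/
theorem exists_WIn_iff_exists_zero {D : Set ℕ} {c : OCode} {F : ℕ → ℕ}
    (hc : ∀ m, c.eval (char D) m = Part.some (F m)) :
    ∃ g : ℕ → ℕ, Primrec g ∧ ∀ z x, x ∈ WIn D (g z) ↔ ∃ n, F (Nat.pair (Nat.pair z x) n) = 0 := by
  obtain ⟨r, hr⟩ := OCode.ofNat_surjective (.rfind' c)
  -- The parameter `z` is hard-wired by a constant program. The numbers 2 and 3 are `left` and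
  -- `right`, whose pair is the identity on `x`; the last 0 starts the search at 0.
  refine ⟨fun z => OCode.compNum r
    (OCode.pairNum (OCode.pairNum (OCode.constNum z) (OCode.pairNum 2 3)) 0),
    OCode.primrec₂_compNum.comp (.const r) (OCode.primrec₂_pairNum.comp
      (OCode.primrec₂_pairNum.comp OCode.primrec_constNum (.const _)) (.const 0)),
    fun z x => ?_⟩
  rw [mem_WIn, OCode.ofNat_compNum, hr]
  simp only [OCode.ofNat_pairNum]
  have harg : (((OCode.ofNat (OCode.constNum z)).pair
      ((OCode.ofNat 2).pair (OCode.ofNat 3))).pair (OCode.ofNat 0)).eval (char D) x =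
      Part.some (Nat.pair (Nat.pair z x) 0) := by
    refine Part.eq_some_iff.2 (OCode.mem_pair_seq.2 ⟨_, OCode.mem_pair_seq.2 ⟨z, ?_, x,
      OCode.mem_pair_seq.2 ⟨x.unpair.1, ?_, x.unpair.2, ?_, Nat.pair_unpair x⟩, rfl⟩, 0, ?_, rfl⟩)
    · exact Part.eq_some_iff.1 (OCode.eval_constNum _ z x)
    · simp [OCode.ofNat, OCode.eval]
    · simp [OCode.ofNat, OCode.eval]
    · simp only [OCode.ofNat, OCode.eval]
      exact Part.mem_some 0
  rw [OCode.eval_comp_of_eq harg, Part.dom_iff_mem]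
  constructor
  · rintro ⟨y, hy⟩
    obtain ⟨w, ⟨h0, -⟩, -⟩ := OCode.mem_rfind_map.1 hy
    rw [hc] at h0
    exact ⟨w, by simpa using (Part.mem_some_iff.1 h0).symm⟩
  · intro h
    classical
    refine ⟨Nat.find h + 0, OCode.mem_rfind_map.2 ⟨Nat.find h, ⟨?_, fun i hi =>
      ⟨F (Nat.pair (Nat.pair z x) i), ?_, Nat.find_min h hi⟩⟩, by simp⟩⟩
    · rw [hc]
      simpa using (Nat.find_spec h).symm
    · rw [hc]
      simp

/-- `Σ⁰_{n+1}` relations are uniformly c.e. in the `n`-th jump of `∅`. -/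
theorem exists_WIn_iff {n : ℕ} {R : ℕ × ℕ → Prop} (hR : IsSigma (n + 1) R) :
    ∃ g : ℕ → ℕ, Primrec g ∧ ∀ z x, x ∈ WIn (jump^[n] ∅) (g z) ↔ R (z, x) := by
  have hu : Primrec fun m : ℕ => ((m.unpair.1.unpair.1, m.unpair.1.unpair.2), m.unpair.2) :=
    ((Primrec.unpair.comp (Primrec.fst.comp .unpair)).pair (Primrec.snd.comp .unpair))
  induction n generalizing R with
  | zero =>
    obtain ⟨Q, hQ, h⟩ := hR
    classical
    obtain ⟨c, hc⟩ := OCode.exists_eval_eq (Primrec.ite (PrimrecPred.comp hQ hu)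
      (Primrec.const 1) (Primrec.const 0))
    obtain ⟨g, hg, hgz⟩ := exists_WIn_iff_exists_zero (D := jump^[0] ∅) (hc _)
    exact ⟨g, hg, fun z x => ((hgz z x).trans (by simp)).trans (h _).symm⟩
  | succ n ih =>
    obtain ⟨Q, hQ, h⟩ := hR
    -- The relation used here ignores its second coordinate, so the set with index `f m` is
    -- everything or empty. Thus `f m` lies in the next jump iff `Q` holds, and one query decides
    -- `Q`.
    obtain ⟨f, hf, hfz⟩ := ih (IsSigma.comp hQ (hu.comp Primrec.fst))
    obtain ⟨b, hb⟩ := OCode.exists_eval_eq hf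
    have hc : ∀ m, (OCode.oracle.comp b).eval (char (jump^[n + 1] ∅)) m =
        Part.some (char (jump^[n + 1] ∅) (f m)) := fun m => OCode.eval_comp_of_eq (hb _ m)
    obtain ⟨g, hg, hgz⟩ := exists_WIn_iff_exists_zero hc
    refine ⟨g, hg, fun z x => ?_⟩
    rw [hgz, h]
    refine exists_congr fun a => ?_
    rw [char_eq_zero, Function.iterate_succ_apply', mem_jump, hfz]
    simp

/-- Programs for the finite partial functions given by lists. -/
theorem exists_lookup_code : ∃ c : Code, ∀ (s : List ℕ) (k y : ℕ),
    y ∈ (c.curry (Encodable.encode s)).eval k ↔ s[k]? = some y := by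
  have h : Primrec fun m : ℕ =>
      ((Encodable.decode (α := List ℕ) m.unpair.1).getD [])[m.unpair.2]? :=
    Primrec.list_getElem?.comp (Primrec.option_getD.comp (Primrec.decode.comp
      (Primrec.fst.comp .unpair)) (.const _)) (Primrec.snd.comp .unpair)
  obtain ⟨c, hc⟩ := Code.exists_code.1 (Partrec.nat_iff.1 h.to_comp.ofOption)
  refine ⟨c, fun s k y => ?_⟩
  rw [Code.eval_curry, hc]
  simp

/-- The use principle. -/
theorem mem_WIn_iff {c : Code} (hc : ∀ (s : List ℕ) (k y : ℕ),
    y ∈ (c.curry (Encodable.encode s)).eval k ↔ s[k]? = some y) {D : Set ℕ} {e x : ℕ} :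
    x ∈ WIn D e ↔ ∃ s : List ℕ, (∀ k < s.length, s.getD k 0 = char D k) ∧
      x ∈ W (Encodable.encode
        (OCode.substOracle (c.curry (Encodable.encode s)) (OCode.ofNat e))) := by
  simp only [mem_WIn, W, Set.mem_ofPred_eq, Denumerable.ofNat_encode, Part.dom_iff_mem]
  constructor
  · rintro ⟨y, hy⟩
    obtain ⟨l, hl⟩ := OCode.exists_use _ _ _ hy
    refine ⟨(List.range l).map (char D), fun k hk => ?_, y, hl _ fun k hk => ?_⟩
    · have : k < l := by simpa using hk
      simp [List.getD, this]
    · rw [hc]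
      simp [hk]
  · rintro ⟨s, hs, y, hy⟩
    refine ⟨y, OCode.eval_of_substOracle (fun k v hv => ?_) _ _ _ hy⟩
    obtain ⟨hk, rfl⟩ := List.getElem?_eq_some_iff.1 ((hc _ _ _).1 hv)
    rw [← hs k hk]
    simp [List.getD, hk]

namespace IsSigma

/-- By the use principle it suffices to guess a finite initial segment of `D`. Checking one entry
asks for membership or nonmembership in `D`, which is `Σ⁰_{n+1}`, and bounded quantification stays
at that level. -/
theorem mem_WIn {n : ℕ} {D : Set ℕ} (hD : IsSigma n (· ∈ D)) :
    IsSigma (n + 1) fun p : ℕ × ℕ => p.2 ∈ WIn D p.1 := by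
  obtain ⟨c, hc⟩ := exists_lookup_code
  have hget : Primrec fun q : List ℕ × ℕ => q.1.getD q.2 0 := Primrec.list_getD 0
  have h1 : IsSigma (n + 1) fun q : List ℕ × ℕ => q.1.getD q.2 0 = char D q.2 := by
    refine (((of_primrecPred (Primrec.eq.comp hget (.const 1))).and (hD.comp .snd).succ).or
      ((of_primrecPred (Primrec.eq.comp hget (.const 0))).and (hD.comp .snd).not)).of_iff fun q => ?_
    by_cases h : q.2 ∈ D <;> simp [char, h]
  have h2 : IsSigma (n + 1) fun q : (ℕ × ℕ) × List ℕ =>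
      ∀ k < q.2.length, q.2.getD k 0 = char D k :=
    h1.forall_lt.comp (Primrec.snd.pair (Primrec.list_length.comp .snd))
  have hW : IsSigma (n + 1) fun p : ℕ × ℕ => p.2 ∈ W p.1 := by
    clear h1 h2 hD
    induction n with
    | zero => exact mem_W
    | succ n ih => exact ih.succ
  have h3 := hW.comp (f := fun q : (ℕ × ℕ) × List ℕ => (Encodable.encode (OCode.substOracle
      (c.curry (Encodable.encode q.2)) (OCode.ofNat q.1.1)), q.1.2))
    ((Primrec.encode.comp (OCode.primrec₂_substOracle.comp
      (Code.primrec₂_curry.comp (.const c) (Primrec.encode.comp .snd))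
      (Primrec.fst.comp .fst))).pair (Primrec.snd.comp .fst))
  exact (h2.and h3).exists_encodable.of_iff fun p => mem_WIn_iff hc

theorem mem_iterate_jump (n : ℕ) : IsSigma n (· ∈ jump^[n] ∅) := by
  induction n with
  | zero => exact of_primrecPred ((PrimrecPred.of_eq (Primrec.eq.comp (.const 0) (.const 1)))
      fun x => by simp)
  | succ n ih =>
    rw [Function.iterate_succ_apply']
    exact ih.mem_WIn.comp (Primrec.id.pair .id)

end IsSigma

/-! ### The reductions to `E_=^2` -/

theorem Reducible.trans {E F G : Setoid ℕ} (h : Reducible E F) (k : Reducible F G) :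
    Reducible E G := by
  obtain ⟨f, hf, hf'⟩ := h
  obtain ⟨g, hg, hg'⟩ := k
  exact ⟨fun x => g (f x), hg.comp hf, fun x y => (hf' x y).trans (hg' _ _)⟩

theorem reducible_EEq {n : ℕ} {E : Setoid ℕ} {R : ℕ × ℕ → Prop} (hR : IsSigma (n + 1) R)
    (hE : ∀ i j, E i j ↔ ∀ x, R (i, x) ↔ R (j, x)) : Reducible E (EEq n) := by
  obtain ⟨g, hg, h⟩ := exists_WIn_iff hR
  refine ⟨g, hg.to_comp, fun i j => (hE i j).trans ?_⟩
  change _ ↔ WIn (jump^[n] ∅) (g i) = WIn (jump^[n] ∅) (g j)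
  simp only [Set.ext_iff, h]

theorem finite_compl_iff {A : Set ℕ} : Aᶜ.Finite ↔ ∃ m, ∀ x, x < m ∨ x ∈ A := by
  constructor
  · intro h
    obtain ⟨m, hm⟩ := h.bddAbove
    refine ⟨m + 1, fun x => or_iff_not_imp_right.2 fun hx => Nat.lt_succ_of_le (hm hx)⟩
  · rintro ⟨m, hm⟩
    exact (Set.finite_lt_nat m).subset fun x hx => (hm x).resolve_right hx

theorem ECof_reducible_EEq : Reducible (ce ECof) (EEq 2) := by
  refine reducible_EEq (R := fun p => (column (W p.1) p.2)ᶜ.Finite) ?_ fun i j => Iff.rfl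
  have h1 : IsSigma 1 fun q : ((ℕ × ℕ) × ℕ) × ℕ =>
      q.2 < q.1.2 ∨ Nat.pair q.2 q.1.1.2 ∈ W q.1.1.1 := by
    refine (IsSigma.of_primrecPred (Primrec.nat_lt.comp .snd (Primrec.snd.comp .fst))).or
      (IsSigma.mem_W.comp (f := fun q : ((ℕ × ℕ) × ℕ) × ℕ => (q.1.1.1, Nat.pair q.2 q.1.1.2)) ?_)
    exact (Primrec.fst.comp (Primrec.fst.comp .fst)).pair
      (Primrec₂.natPair.comp .snd (Primrec.snd.comp (Primrec.fst.comp .fst)))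
  exact h1.forall_nat.exists_nat.of_iff fun p => finite_compl_iff

theorem exists_W_eq_column (i n : ℕ) : ∃ e, W e = column (W i) n := by
  obtain ⟨g, -, hg⟩ := exists_W_iff (R := fun p : ℕ × ℕ => Nat.pair p.2 n ∈ W i)
    (IsSigma.mem_W.comp ((Primrec.const i).pair (Primrec₂.natPair.comp .snd (.const n))))
  exact ⟨g 0, Set.ext fun x => hg 0 x⟩

/-- Columns of c.e. sets are c.e., so the indices of the columns determine the set of columns. -/
theorem ESet_reducible_EEq : Reducible (ce ESet) (EEq 2) := by
  refine reducible_EEq (R := fun p => ∃ n, W p.2 = column (W p.1) n) ?_ fun i j => ?_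
  · have hl : IsSigma 1 fun q : ((ℕ × ℕ) × ℕ) × ℕ => q.2 ∈ W q.1.1.2 :=
      IsSigma.mem_W.comp ((Primrec.snd.comp (Primrec.fst.comp .fst)).pair .snd)
    have hr : IsSigma 1 fun q : ((ℕ × ℕ) × ℕ) × ℕ => Nat.pair q.2 q.1.2 ∈ W q.1.1.1 :=
      IsSigma.mem_W.comp ((Primrec.fst.comp (Primrec.fst.comp .fst)).pair
        (Primrec₂.natPair.comp .snd (Primrec.snd.comp .fst)))
    have h : IsSigma 3 fun q : (ℕ × ℕ) × ℕ =>
        ∀ x, x ∈ W q.1.2 ↔ Nat.pair x q.2 ∈ W q.1.1 := by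
      -- A point where the two c.e. sets differ is a `Σ⁰_2` event; its negation is therefore
      -- available at level 3.
      have h2 := ((hl.succ.and hr.not).or (hl.not.and hr.succ)).exists_nat.not
      refine h2.of_iff fun q => ?_
      simp only [not_exists]
      exact forall_congr' fun x => by tauto
    exact h.exists_nat.of_iff fun p => by simp only [Set.ext_iff]; rfl
  · change {C | ∃ n, C = column (W i) n} = {C | ∃ n, C = column (W j) n} ↔ _
    constructor
    · intro h x
      exact Set.ext_iff.1 h (W x)
    · refine fun h => Set.ext fun C => ⟨?_, ?_⟩
      · rintro ⟨n, rfl⟩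
        obtain ⟨e, he⟩ := exists_W_eq_column i n
        obtain ⟨m, hm⟩ := (h e).1 ⟨n, he⟩
        exact ⟨m, he.symm.trans hm⟩
      · rintro ⟨n, rfl⟩
        obtain ⟨e, he⟩ := exists_W_eq_column j n
        obtain ⟨m, hm⟩ := (h e).2 ⟨n, he⟩
        exact ⟨m, he.symm.trans hm⟩

/-! ### The reductions of `E_=^2` -/

theorem IsSigma.exists_forall_exists {α : Type} [Primcodable α] {R : α → Prop} (hR : IsSigma 3 R) :
    ∃ P : ((α × ℕ) × ℕ) × ℕ → Prop, PrimrecPred P ∧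
      ∀ x, R x ↔ ∃ a, ∀ b, ∃ c, P (((x, a), b), c) := by
  obtain ⟨Q, ⟨Q', ⟨Q'', hP, h''⟩, h'⟩, h⟩ := hR
  exact ⟨fun p => ¬ Q'' p, PrimrecPred.not hP, fun x => by simp only [h, h', h'', not_exists, not_not, not_forall]⟩

theorem isSigma_mem_WIn (n : ℕ) : IsSigma (n + 1) fun p : ℕ × ℕ => p.2 ∈ WIn (jump^[n] ∅) p.1 :=
  (IsSigma.mem_iterate_jump n).mem_WIn

/-- If the columns of `A` are initial segments of the rows `{⟨n, x⟩ | x}`, all finite ones being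
present, then a full row is a column exactly when some column exhausts it. -/
theorem setOf_column_eq {A : Set ℕ} {T : ℕ → ℕ → ℕ → Prop}
    (hA : ∀ m, m ∈ A ↔ m.unpair.1.unpair.1 = m.unpair.2.unpair.1 ∧
      ((m.unpair.2.unpair.2.unpair.1 = 0 ∧ m.unpair.1.unpair.2 < m.unpair.2.unpair.2.unpair.2) ∨
        (m.unpair.2.unpair.2.unpair.1 ≠ 0 ∧ ∀ b < m.unpair.1.unpair.2,
          T m.unpair.2.unpair.1 m.unpair.2.unpair.2.unpair.2 b))) (C : Set ℕ) :
    (∃ n, C = column A n) ↔ (∃ n k, C = {y | y.unpair.1 = n ∧ y.unpair.2 < k}) ∨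
      ∃ n, (∃ k, ∀ b, T n k b) ∧ C = {y | y.unpair.1 = n} := by
  -- A column index is `⟨n, ⟨t, k⟩⟩`: row `n`, then a tag `t` that is 0 for the segment of length
  -- `k` and nonzero for testing the guess `k`.
  have h0 : ∀ n k, column A (Nat.pair n (Nat.pair 0 k)) =
      {y | y.unpair.1 = n ∧ y.unpair.2 < k} := fun n k => by ext y; simp [column, hA]
  have h1 : ∀ n t k, t ≠ 0 → column A (Nat.pair n (Nat.pair t k)) =
      {y | y.unpair.1 = n ∧ ∀ b < y.unpair.2, T n k b} := fun n t k ht => by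
    ext y; simp [column, hA, ht]
  constructor
  · rintro ⟨m, rfl⟩
    obtain ⟨n, t, k, rfl⟩ : ∃ n t k, m = Nat.pair n (Nat.pair t k) :=
      ⟨m.unpair.1, m.unpair.2.unpair.1, m.unpair.2.unpair.2, by simp⟩
    rcases eq_or_ne t 0 with rfl | ht
    · exact Or.inl ⟨n, k, h0 n k⟩
    · rw [h1 n t k ht]
      by_cases hT : ∀ b, T n k b
      · exact Or.inr ⟨n, ⟨k, hT⟩, by simp [hT]⟩
      · classical
        push Not at hT
        -- Membership of `⟨n, x⟩` tests only `b < x`, so the first failing `b` still admits `x = b`.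
        refine Or.inl ⟨n, Nat.find hT + 1, ?_⟩
        ext y
        simp only [Set.mem_ofPred_eq, Nat.lt_succ_iff, Nat.le_find_iff, not_not]
  · rintro (⟨n, k, rfl⟩ | ⟨n, ⟨k, hk⟩, rfl⟩)
    · exact ⟨_, (h0 n k).symm⟩
    · exact ⟨Nat.pair n (Nat.pair 1 k), by simp [h1 n 1 k one_ne_zero, hk]⟩

theorem EEq_reducible_ESet : Reducible (EEq 2) (ce ESet) := by
  obtain ⟨P, hP, h⟩ := (isSigma_mem_WIn 2).exists_forall_exists
  let S : ℕ × ℕ → Prop := fun p => p.2.unpair.1.unpair.1 = p.2.unpair.2.unpair.1 ∧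
    ((p.2.unpair.2.unpair.2.unpair.1 = 0 ∧
        p.2.unpair.1.unpair.2 < p.2.unpair.2.unpair.2.unpair.2) ∨
      (p.2.unpair.2.unpair.2.unpair.1 ≠ 0 ∧ ∀ b < p.2.unpair.1.unpair.2,
        ∃ c, P ((((p.1, p.2.unpair.2.unpair.1), p.2.unpair.2.unpair.2.unpair.2), b), c)))
  have hS : IsSigma 1 S := by
    have u1 : ∀ {f : ℕ × ℕ → ℕ}, Primrec f → Primrec fun p => (f p).unpair.1 :=
      fun hf => Primrec.fst.comp (Primrec.unpair.comp hf)
    have u2 : ∀ {f : ℕ × ℕ → ℕ}, Primrec f → Primrec fun p => (f p).unpair.2 :=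
      fun hf => Primrec.snd.comp (Primrec.unpair.comp hf)
    have hs : Primrec fun p : ℕ × ℕ => p.2 := .snd
    have hP' := ((IsSigma.of_primrecPred (n := 1) hP).exists_nat.forall_lt).comp
      (f := fun p : ℕ × ℕ => (((p.1, p.2.unpair.2.unpair.1), p.2.unpair.2.unpair.2.unpair.2),
        p.2.unpair.1.unpair.2)) (((Primrec.fst.pair (u1 (u2 hs))).pair (u2 (u2 (u2 hs)))).pair
          (u2 (u1 hs)))
    have h0 : PrimrecPred fun p : ℕ × ℕ => p.2.unpair.2.unpair.2.unpair.1 = 0 :=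
      Primrec.eq.comp (u1 (u2 (u2 hs))) (.const 0)
    exact (IsSigma.of_primrecPred (Primrec.eq.comp (u1 (u1 hs)) (u1 (u2 hs)))).and
      ((IsSigma.of_primrecPred (h0.and (Primrec.nat_lt.comp (u2 (u1 hs)) (u2 (u2 (u2 hs)))))).or
        ((IsSigma.of_primrecPred h0.not).and hP'))
  obtain ⟨g, hg, hgz⟩ := exists_W_iff hS
  have key := fun z => setOf_column_eq (A := W (g z))
    (T := fun n k b => ∃ c, P ((((z, n), k), b), c)) fun m => hgz z m
  simp only [← h] at key
  refine ⟨g, hg.to_comp, fun i j => ?_⟩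
  change WIn (jump^[2] ∅) i = WIn (jump^[2] ∅) j ↔
    {C | ∃ n, C = column (W (g i)) n} = {C | ∃ n, C = column (W (g j)) n}
  constructor
  · intro hij
    ext C
    simp only [Set.mem_ofPred_eq, key, hij]
  · intro hij
    have hrow : ∀ z n, n ∈ WIn (jump^[2] ∅) z ↔
        {y : ℕ | y.unpair.1 = n} ∈ {C | ∃ n, C = column (W (g z)) n} := by
      intro z n
      rw [Set.mem_ofPred_eq, key]
      constructor
      · exact fun hn => Or.inr ⟨n, hn, rfl⟩
      · rintro (⟨m, k, hm⟩ | ⟨m, hm, hnm⟩)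
        -- A segment of length `k` omits `⟨n, k⟩`, so it is not a full row.
        · have := (Set.ext_iff.1 hm (Nat.pair n k)).1 (by simp)
          simp at this
        · have := (Set.ext_iff.1 hnm (Nat.pair n 0)).1 (by simp)
          obtain rfl : n = m := by simpa using this
          exact hm
    ext n
    rw [hrow, hrow, hij]

/-- The set of stages that are followed by a stage with at most the same value is cofinite iff
some value is taken infinitely often. -/
theorem finite_compl_setOf_exists_le_iff (f : ℕ → ℕ) :
    {s | ∃ t, s < t ∧ f t ≤ f s}ᶜ.Finite ↔ ∃ v, {s | f s = v}.Infinite := by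
  constructor
  · intro hfin
    by_contra! hf
    obtain ⟨N, hN⟩ := hfin.bddAbove
    -- Past `N`, take the least value and the last stage `s` having it: nothing later is as small,
    -- so `s > N` lies in the complement.
    obtain ⟨t, ht, hmin⟩ := exists_minimalFor_of_wellFoundedLT (fun t => N < t) f ⟨N + 1, by simp⟩
    obtain ⟨s, hs⟩ := ((hf (f t)).subset
      (Set.inter_subset_left (s := {s | f s = f t}) (t := {s | N < s}))).exists_maximal ⟨t, rfl, ht⟩
    have : s ∈ {s | ∃ t, s < t ∧ f t ≤ f s}ᶜ := by
      rintro ⟨r, hr, hfr⟩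
      have hrN : N < r := lt_trans hs.1.2 hr
      have hsv : f s = f t := hs.1.1
      have : f r = f t := le_antisymm (hfr.trans hsv.le) (by
        by_contra! hlt
        exact absurd (hmin hrN hlt.le) (not_le.2 hlt))
      exact absurd (hs.2 ⟨this, hrN⟩ hr.le) (not_le.2 hr)
    exact absurd (hN this) (not_le.2 hs.1.2)
  · intro h
    classical
    -- Below the least value taken infinitely often there are only finitely many stages; every other
    -- stage is followed by that value.
    have hfin : {s | f s < Nat.find h}.Finite := by
      have : {s | f s < Nat.find h} = ⋃ v ∈ Set.Iio (Nat.find h), {s | f s = v} := by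
        ext s; simp
      rw [this]
      exact (Set.finite_Iio _).biUnion fun v hv => Set.not_infinite.1 (Nat.find_min h hv)
    refine hfin.subset fun s hs => ?_
    by_contra hlt
    obtain ⟨t, ht, hst⟩ := (Nat.find_spec h).exists_gt s
    exact hs ⟨t, hst, (le_of_eq ht).trans (not_lt.1 hlt)⟩

/-- `c` is the least bound for witnesses `P k b' ·` for all `b' < b`. -/
def IsLeastBound (P : ℕ → ℕ → ℕ → Prop) (k b c : ℕ) : Prop :=
  (∀ b' < b, ∃ c' < c, P k b' c') ∧ ∀ d < c, ¬ ∀ b' < b, ∃ c' < d, P k b' c'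

open Classical in
/-- The value `2 k` at the stages `⟨k, b, c⟩` with `c` a least bound, and an odd value not taken
elsewhere at the other stages. -/
noncomputable def stageValue (P : ℕ → ℕ → ℕ → Prop) (s : ℕ) : ℕ :=
  if IsLeastBound P s.unpair.1 s.unpair.2.unpair.1 s.unpair.2.unpair.2 then 2 * s.unpair.1
  else 2 * s + 1

/-- For given `k` and `b` a least bound is unique, and it exists iff all `b' < b` have witnesses. So
`2 k` is taken once for each such `b`, while each odd value is taken at most once. -/
theorem exists_infinite_stageValue_iff (P : ℕ → ℕ → ℕ → Prop) :
    (∃ v, {s | stageValue P s = v}.Infinite) ↔ ∃ k, ∀ b, ∃ c, P k b c := by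
  constructor
  · rintro ⟨v, hv⟩
    have hgood : ∀ s, stageValue P s = v → stageValue P s = 2 * s.unpair.1 ∧
        IsLeastBound P s.unpair.1 s.unpair.2.unpair.1 s.unpair.2.unpair.2 := by
      intro s hs
      by_contra hbad
      refine hv ((Set.finite_singleton s).subset fun t ht => ?_)
      have ht : stageValue P t = v := ht
      simp only [stageValue] at hs ht hbad
      split_ifs at hs ht hbad <;> simp_all <;> omega
    obtain ⟨s₀, hs₀⟩ := hv.nonempty
    refine ⟨s₀.unpair.1, fun b => ?_⟩
    have hk : ∀ s, stageValue P s = v → s.unpair.1 = s₀.unpair.1 := fun s hs => by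
      have h1 := (hgood s hs).1
      have h2 := (hgood s₀ hs₀).1
      have h3 : stageValue P s₀ = v := hs₀
      omega
    -- Uniqueness of least bounds makes `b` determine the stage, so infinitely many stages give
    -- unboundedly large `b`.
    have hinj : Set.InjOn (fun s : ℕ => s.unpair.2.unpair.1) {s | stageValue P s = v} := by
      intro s hs t ht hst
      have hst : s.unpair.2.unpair.1 = t.unpair.2.unpair.1 := hst
      have h1 := (hgood s hs).2
      have h2 := (hgood t ht).2
      rw [hk s hs, hst] at h1
      rw [hk t ht] at h2
      have hc : s.unpair.2.unpair.2 = t.unpair.2.unpair.2 := by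
        rcases lt_trichotomy s.unpair.2.unpair.2 t.unpair.2.unpair.2 with h | h | h
        · exact absurd h1.1 (h2.2 _ h)
        · exact h
        · exact absurd h2.1 (h1.2 _ h)
      rw [← Nat.pair_unpair s, ← Nat.pair_unpair t, ← Nat.pair_unpair s.unpair.2,
        ← Nat.pair_unpair t.unpair.2, hk s hs, hk t ht, hst, hc]
    obtain ⟨_, ⟨s, hs, rfl⟩, hb⟩ := (hv.image hinj).exists_gt b
    obtain ⟨c, -, hc⟩ := (hgood s hs).2.1 b hb
    exact ⟨c, by rwa [hk s hs] at hc⟩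
  · rintro ⟨k, hk⟩
    choose w hw using hk
    have hex : ∀ b, ∃ c, ∀ b' < b, ∃ c' < c, P k b' c' := fun b =>
      ⟨(Finset.range b).sup w + 1, fun b' hb => ⟨w b', Nat.lt_succ_of_le
        (Finset.le_sup (f := w) (Finset.mem_range.2 hb)), hw b'⟩⟩
    classical
    refine ⟨2 * k, Set.infinite_of_injective_forall_mem
      (f := fun b => Nat.pair k (Nat.pair b (Nat.find (hex b)))) ?_ fun b => ?_⟩
    · intro b b' h
      simp only [Nat.pair_eq_pair] at h
      exact h.2.1
    · have : IsLeastBound P k b (Nat.find (hex b)) :=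
        ⟨Nat.find_spec (hex b), fun d hd => Nat.find_min (hex b) hd⟩
      simp [stageValue, this]

/-- Carrying the bound `c` in the stage makes every quantifier in `IsLeastBound` bounded. -/
theorem primrec_stageValue {α : Type} [Primcodable α] {P : ((α × ℕ) × ℕ) × ℕ → Prop}
    (hP : PrimrecPred P) :
    Primrec fun q : α × ℕ => stageValue (fun k b c => P (((q.1, k), b), c)) q.2 := by
  have h1 : IsSigma 0 fun r : (((α × ℕ) × ℕ) × ℕ) => ∃ c' < r.2, P (r.1, c') :=
    (IsSigma.exists_lt_forall_lt (n := 0) hP).1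
  have h2 : IsSigma 0 fun r : ((α × ℕ) × ℕ) × ℕ =>
      ∀ b' < r.2, ∃ c' < r.1.2, P ((r.1.1, b'), c') :=
    (h1.comp (f := fun r : ((α × ℕ) × ℕ) × ℕ => ((r.1.1, r.2), r.1.2))
      (((Primrec.fst.comp .fst).pair .snd).pair (Primrec.snd.comp .fst))).forall_lt
  have h3 : IsSigma 0 fun r : ((α × ℕ) × ℕ) × ℕ =>
      ∀ d < r.2, ¬ ∀ b' < r.1.2, ∃ c' < d, P ((r.1.1, b'), c') :=
    IsSigma.forall_lt (n := 0) (R := fun r : ((α × ℕ) × ℕ) × ℕ =>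
        ¬ ∀ b' < r.1.2, ∃ c' < r.2, P ((r.1.1, b'), c'))
      (PrimrecPred.not (h2.comp (f := fun r : ((α × ℕ) × ℕ) × ℕ => ((r.1.1, r.2), r.1.2))
        (((Primrec.fst.comp .fst).pair .snd).pair (Primrec.snd.comp .fst))))
  have hu := Primrec.unpair.comp (Primrec.snd (α := α) (β := ℕ))
  have hu' := Primrec.unpair.comp (Primrec.snd.comp hu)
  have hak := (Primrec.fst (α := α) (β := ℕ)).pair (Primrec.fst.comp hu)
  have h4 : PrimrecPred fun q : α × ℕ => IsLeastBound (fun k b c => P (((q.1, k), b), c))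
      q.2.unpair.1 q.2.unpair.2.unpair.1 q.2.unpair.2.unpair.2 :=
    PrimrecPred.and (h2.comp ((hak.pair (Primrec.snd.comp hu')).pair (Primrec.fst.comp hu')))
      (h3.comp ((hak.pair (Primrec.fst.comp hu')).pair (Primrec.snd.comp hu')))
  classical
  exact Primrec.ite h4 (Primrec.nat_mul.comp (.const 2) (Primrec.fst.comp hu))
    (Primrec.succ.comp (Primrec.nat_mul.comp (.const 2) .snd))

/-- Column `n` receives `s` once a later stage with at most the same value appears, which is a
`Σ⁰_1` event. -/
theorem EEq_reducible_ECof : Reducible (EEq 2) (ce ECof) := by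
  obtain ⟨P, hP, h⟩ := (isSigma_mem_WIn 2).exists_forall_exists
  obtain ⟨V, hV, hVeq⟩ : ∃ V : (ℕ × ℕ) × ℕ → ℕ, Primrec V ∧
      ∀ p s, V (p, s) = stageValue (fun k b c => P (((p, k), b), c)) s :=
    ⟨_, primrec_stageValue hP, fun _ _ => rfl⟩
  let S : ℕ × ℕ → Prop := fun p => ∃ t, p.2.unpair.1 < t ∧
    V ((p.1, p.2.unpair.2), t) ≤ V ((p.1, p.2.unpair.2), p.2.unpair.1)
  have hS : IsSigma 1 S := by
    have hu := Primrec.unpair.comp (Primrec.snd.comp (Primrec.fst (α := ℕ × ℕ) (β := ℕ)))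
    have hp := (Primrec.fst.comp (Primrec.fst (α := ℕ × ℕ) (β := ℕ))).pair (Primrec.snd.comp hu)
    have h1 : PrimrecPred fun q : (ℕ × ℕ) × ℕ => q.1.2.unpair.1 < q.2 :=
      Primrec.nat_lt.comp (Primrec.fst.comp hu) .snd
    have h2 : PrimrecPred fun q : (ℕ × ℕ) × ℕ =>
        V ((q.1.1, q.1.2.unpair.2), q.2) ≤ V ((q.1.1, q.1.2.unpair.2), q.1.2.unpair.1) :=
      Primrec.nat_le.comp (hV.comp (hp.pair .snd)) (hV.comp (hp.pair (Primrec.fst.comp hu)))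
    exact (IsSigma.of_primrecPred (h1.and h2)).exists_nat
  obtain ⟨g, hg, hgz⟩ := exists_W_iff hS
  have key : ∀ z n, (column (W (g z)) n)ᶜ.Finite ↔ n ∈ WIn (jump^[2] ∅) z := by
    intro z n
    have : column (W (g z)) n = {s | ∃ t, s < t ∧ V ((z, n), t) ≤ V ((z, n), s)} := by
      ext s
      simp [column, hgz, S]
    rw [this, finite_compl_setOf_exists_le_iff fun s => V ((z, n), s)]
    simp only [hVeq]
    rw [exists_infinite_stageValue_iff, ← h (z, n)]
  refine ⟨g, hg.to_comp, fun i j => ?_⟩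
  change WIn (jump^[2] ∅) i = WIn (jump^[2] ∅) j ↔
    ∀ n, (column (W (g i)) n)ᶜ.Finite ↔ (column (W (g j)) n)ᶜ.Finite
  simp only [key, Set.ext_iff]

end CompRed

theorem mainTheorem10 :
    CompRed.Bireducible (CompRed.ce CompRed.ECof) (CompRed.ce CompRed.ESet) ∧
      CompRed.Bireducible (CompRed.ce CompRed.ESet) (CompRed.EEq 2) ∧
      CompRed.Bireducible (CompRed.ce CompRed.ECof) (CompRed.EEq 2) :=
  ⟨⟨CompRed.ECof_reducible_EEq.trans CompRed.EEq_reducible_ESet,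
      CompRed.ESet_reducible_EEq.trans CompRed.EEq_reducible_ECof⟩,
    ⟨CompRed.ESet_reducible_EEq, CompRed.EEq_reducible_ESet⟩,
    CompRed.ECof_reducible_EEq, CompRed.EEq_reducible_ECof⟩
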